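/- A graphical coordination game is played on a connected simple graph $G$ with node set $\{1,\dots,N\}$, $N\ge 3$. Each agent $i$ chooses $a_i\in\{x,y\}$. For $\alpha>0$ let $V^\alpha(x,x)=1+\alpha$, $V^\alpha(y,y)=1$, $V^\alpha(x,y)=V^\alpha(y,x)=0$ and $U_i^\alpha(a)=\sum_{j\sim i}V^\alpha(a_i,a_j)$. Fix the system gain $\alpha_{\rm sys}>0$; the welfare is $W(a)=\sum_i U_i^{\alpha_{\rm sys}}(a)$. For finite non-empty action sets $\mathcal A_i\subseteq\{x,y\}$, $\mathcal A=\prod_i\mathcal A_i$, and utilities $(U_i)$, log-linear learning with parameter $\beta>0$ is the Markov chain on $\mathcal A$ in which, at each step, a uniformly random agent $i$ switches to $z\in\mathcal A_i$ with probability $e^{\beta U_i(z,a_{-i})}/\sum_{z'\in\mathcal A_i}e^{\beta U_i(z',a_{-i})}$ and all other agents repeat their actions; $\mathrm{LLL}(\mathcal A,(U_i))$ is the set of profiles $a$ with $\lim_{\beta\to\infty}\pi_\beta(a)>0$, where $\pi_\beta$ is the stationary distribution. *Broad attacks.* A target set is a pair $S=(S_x,S_y)$ of disjoint sets with union $\{1,\dots,N\}$.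 Put $\tilde U_i^\alpha(a)=U_i^\alpha(a)+\mathbf 1(a_i=y)$ for $i\in S_y$ and $\tilde U_i^\alpha(a)=U_i^\alpha(a)+(1+\alpha)\mathbf 1(a_i=x)$ for $i\in S_x$. With $\mathcal A=\{x,y\}^N$, let $$R_b(\alpha,S;G)=1-\frac{\min_{a\in \mathrm{LLL}(\mathcal A,(\tilde U_i^\alpha))}W(a)}{\max_{a\in\mathcal A}W(a)},\qquad R_b^*(\alpha)=\sup_{N\ge3,\,G,\,S}R_b(\alpha,S;G).$$ *Focused attacks.* A fixed set is a pair $F=(F_x,F_y)$ of disjoint sets of agents whose union is non-empty and is not the set of all agents. Let $\mathcal A(F)$ be the set of profiles with $a_i=x$ for $i\in F_x$ and $a_i=y$ for $i\in F_y$, and let $$R_f(\alpha,F;G)=1-\frac{\min_{a\in \mathrm{LLL}(\mathcal A(F),(U_i^\alpha))}W(a)}{\max_{a\in\mathcal A(F)}W(a)},\qquad R_f^*(\alpha)=\sup_{N\ge3,\,G,\,F}R_f(\alpha,F;G).$$ *Linear programs.* For a vector of gains $\boldsymbol\alpha=(\alpha_1<\dots<\alpha_M)$ with $M\ge1$ and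 $\alpha_1\ge\alpha_{\rm sys}$, and $\Delta_M=\{p\in\mathbb R^M_{\ge0}:\sum_jp_j=1\}$, let $$v_b(\gamma_f,\boldsymbol\alpha)=\min\Big\{v\in[0,1]:\ \exists p\in\Delta_M\ \forall k:\ R_b^*(\alpha_k)\sum_{j\le k}p_j\le v,\ \ R_f^*(\alpha_k)\sum_{j\ge k}p_j\le\gamma_f\Big\},$$ $$v_f(\gamma_b,\boldsymbol\alpha)=\min\Big\{v\in[0,1]:\ \exists p\in\Delta_M\ \forall k:\ R_f^*(\alpha_k)\sum_{j\ge k}p_j\le v,\ \ R_b^*(\alpha_k)\sum_{j\le k}p_j\le\gamma_b\Big\},$$ $$\mathrm{Par}(\boldsymbol\alpha)=\{(v_f(\gamma_b,\boldsymbol\alpha),\gamma_b):\ \gamma_b\in[R_b^*(\alpha_M),R_b^*(\alpha_1)]\}.$$ **Claim.** Let $\boldsymbol\alpha=(\alpha_1<\dots<\alpha_M)$ and $\boldsymbol\alpha'=(\alpha'_1<\dots<\alpha'_{M'})$ be vectors of gains, all at least $\alpha_{\rm sys}$, with $1\le M<M'$, such that every $\alpha_j$ occurs among the entries of $\boldsymbol\alpha'$.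 Then: 1. for every $\gamma_b\in[R_b^*(\alpha_M),1]$, the minima $v_f(\gamma_b,\boldsymbol\alpha)$ and $v_f(\gamma_b,\boldsymbol\alpha')$ exist and $v_f(\gamma_b,\boldsymbol\alpha')\le v_f(\gamma_b,\boldsymbol\alpha)$; 2. for every $\gamma_f\in[R_f^*(\alpha_1),1]$, the minima $v_b(\gamma_f,\boldsymbol\alpha)$ and $v_b(\gamma_f,\boldsymbol\alpha')$ exist and $v_b(\gamma_f,\boldsymbol\alpha')\le v_b(\gamma_f,\boldsymbol\alpha)$; 3. every point of $\mathrm{Par}(\boldsymbol\alpha)$ is dominated by a point of $\mathrm{Par}(\boldsymbol\alpha')$: for each $r\in\mathrm{Par}(\boldsymbol\alpha)$ there is $r'\in\mathrm{Par}(\boldsymbol\alpha')$ with $r'\le r$ componentwise. -/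

import Mathlib

open Filter Topology

namespace CoordGame

/-- The two actions of every agent. -/
inductive Action
  | x
  | y
  deriving DecidableEq

instance : Fintype Action where
  elems := {.x, .y}
  complete := by intro a; cases a <;> simp

/-- The `2 × 2` coordination payoff `V^α`: coordinating on `x` pays `1 + α`, on `y` pays `1`,
miscoordination pays `0`. -/
def payoff (α : ℝ) : Action → Action → ℝ
  | .x, .x => 1 + α
  | .y, .y => 1
  | .x, .y => 0
  | .y, .x => 0

open Classical in
/-- The utility `U_i^α(a)` of agent `i`: the sum of the payoffs `V^α(a_i, a_j)` over the
neighbours `j` of `i`. For `α = α_sys` it is the benefit `W_i(a)`. -/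
noncomputable def utility {N : ℕ} (G : SimpleGraph (Fin N)) (α : ℝ) (i : Fin N)
    (a : Fin N → Action) : ℝ :=
  ∑ j ∈ Finset.univ.filter (fun j => G.Adj i j), payoff α (a i) (a j)

/-- The welfare: the sum of the benefits of all agents. -/
noncomputable def welfare {N : ℕ} (G : SimpleGraph (Fin N)) (αsys : ℝ) (a : Fin N → Action) : ℝ :=
  ∑ i, utility G αsys i a

/-! ### Log-linear learning -/

/-- The probability that agent `i`, when it revises its action in state `a`, chooses `z` among the
actions `A i` available to it, at rationality `β`. -/
noncomputable def choiceProb {N : ℕ} (A : Fin N → Finset Action)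
    (U : Fin N → (Fin N → Action) → ℝ) (β : ℝ) (i : Fin N) (a : Fin N → Action)
    (z : Action) : ℝ :=
  Real.exp (β * U i (Function.update a i z)) /
    ∑ z' ∈ A i, Real.exp (β * U i (Function.update a i z'))

/-- The transition probability from `a` to `b` of log-linear learning: a uniformly random agent
revises its action, all others repeat theirs. -/
noncomputable def transProb {N : ℕ} (A : Fin N → Finset Action)
    (U : Fin N → (Fin N → Action) → ℝ) (β : ℝ) (a b : Fin N → Action) : ℝ :=
  ∑ i : Fin N, (1 / (N : ℝ)) *
    ∑ z ∈ A i, if Function.update a i z = b then choiceProb A U β i a z else 0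

/-- `π` is a stationary distribution of log-linear learning on the profiles `∏ i, A i`. -/
def IsStationary {N : ℕ} (A : Fin N → Finset Action)
    (U : Fin N → (Fin N → Action) → ℝ) (β : ℝ) (π : (Fin N → Action) → ℝ) : Prop :=
  (∀ a ∈ Fintype.piFinset A, 0 ≤ π a) ∧
  (∑ a ∈ Fintype.piFinset A, π a = 1) ∧
  ∀ b ∈ Fintype.piFinset A, ∑ a ∈ Fintype.piFinset A, π a * transProb A U β a b = π b

/-- The stochastically stable states: the profiles whose probability under the stationary
distribution `π_β` of log-linear learning has a positive limit as `β → ∞`. -/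
def LLL {N : ℕ} (A : Fin N → Finset Action) (U : Fin N → (Fin N → Action) → ℝ) :
    Set (Fin N → Action) :=
  {a | a ∈ Fintype.piFinset A ∧
    ∃ π : ℝ → (Fin N → Action) → ℝ, (∀ β, 0 < β → IsStationary A U β (π β)) ∧
      ∃ c : ℝ, 0 < c ∧ Tendsto (fun β => π β a) atTop (𝓝 c)}

/-- The lowest welfare of a stochastically stable state divided by the highest welfare of an
available profile. -/
noncomputable def efficiency {N : ℕ} (G : SimpleGraph (Fin N)) (αsys : ℝ)
    (A : Fin N → Finset Action) (U : Fin N → (Fin N → Action) → ℝ) : ℝ :=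
  sInf (welfare G αsys '' LLL A U) /
    sSup (welfare G αsys '' {a | a ∈ Fintype.piFinset A})

/-! ### Broad attacks -/

/-- `(Sx, Sy)` is a target set: every agent gets either an `x`-imposter or a `y`-imposter. -/
def IsTargetSet {N : ℕ} (Sx Sy : Finset (Fin N)) : Prop :=
  Disjoint Sx Sy ∧ Sx ∪ Sy = Finset.univ

/-- The perceived utility of agent `i` in the presence of the imposters. -/
noncomputable def perceivedUtility {N : ℕ} (G : SimpleGraph (Fin N)) (α : ℝ)
    (Sx Sy : Finset (Fin N)) (i : Fin N) (a : Fin N → Action) : ℝ :=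
  utility G α i a + (if i ∈ Sy ∧ a i = .y then 1 else 0) +
    (if i ∈ Sx ∧ a i = .x then 1 + α else 0)

/-- The risk `R_b(α, S; G)` from the broad attack `S = (Sx, Sy)`. -/
noncomputable def broadRisk {N : ℕ} (αsys α : ℝ) (Sx Sy : Finset (Fin N))
    (G : SimpleGraph (Fin N)) : ℝ :=
  1 - efficiency G αsys (fun _ => Finset.univ) (perceivedUtility G α Sx Sy)

/-- The worst-case risk `R_b^*(α)` over all connected graphs with at least three nodes and all
target sets. -/
noncomputable def worstBroadRisk (αsys α : ℝ) : ℝ :=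
  sSup {r | ∃ (N : ℕ) (G : SimpleGraph (Fin N)) (Sx Sy : Finset (Fin N)),
    3 ≤ N ∧ G.Connected ∧ IsTargetSet Sx Sy ∧ r = broadRisk αsys α Sx Sy G}

/-! ### Focused attacks -/

/-- `(Fx, Fy)` is a fixed set: disjoint sets of agents fixed to `x` and to `y`; at least one
agent, but not every agent, is fixed. -/
def IsFixedSet {N : ℕ} (Fx Fy : Finset (Fin N)) : Prop :=
  Disjoint Fx Fy ∧ (Fx ∪ Fy).Nonempty ∧ Fx ∪ Fy ≠ Finset.univ

/-- The actions left to agent `i` by the fixed set `(Fx, Fy)`. -/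
def fixedActions {N : ℕ} (Fx Fy : Finset (Fin N)) (i : Fin N) : Finset Action :=
  if i ∈ Fx then {.x} else if i ∈ Fy then {.y} else Finset.univ

/-- The risk `R_f(α, F; G)` from the focused attack `F = (Fx, Fy)`. -/
noncomputable def focusedRisk {N : ℕ} (αsys α : ℝ) (Fx Fy : Finset (Fin N))
    (G : SimpleGraph (Fin N)) : ℝ :=
  1 - efficiency G αsys (fixedActions Fx Fy) (utility G α)

/-- The worst-case risk `R_f^*(α)` over all connected graphs with at least three nodes and all
fixed sets. The maximum is a supremum: it need not be attained when `α` is irrational. -/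
noncomputable def worstFocusedRisk (αsys α : ℝ) : ℝ :=
  sSup {r | ∃ (N : ℕ) (G : SimpleGraph (Fin N)) (Fx Fy : Finset (Fin N)),
    3 ≤ N ∧ G.Connected ∧ IsFixedSet Fx Fy ∧ r = focusedRisk αsys α Fx Fy G}

/-! ### The linear programs -/

/-- The lower triangular matrix `A_b(α)`, whose `k`-th row is `R_b^*(α_k)` in the columns
`j ≤ k` and `0` elsewhere. -/
noncomputable def broadMatrix (αsys : ℝ) {M : ℕ} (α : Fin M → ℝ) : Matrix (Fin M) (Fin M) ℝ :=
  Matrix.of fun k j => if j ≤ k then worstBroadRisk αsys (α k) else 0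

/-- The upper triangular matrix `A_f(α)`, whose `k`-th row is `R_f^*(α_k)` in the columns
`j ≥ k` and `0` elsewhere. -/
noncomputable def focusedMatrix (αsys : ℝ) {M : ℕ} (α : Fin M → ℝ) : Matrix (Fin M) (Fin M) ℝ :=
  Matrix.of fun k j => if k ≤ j then worstFocusedRisk αsys (α k) else 0

/-- The objective values `v` of the feasible points `(p, v)` of the linear program for `v_b`:
`p ∈ Δ_M`, `v ∈ [0,1]`, `A_b(α) p ≤ v 𝟙`, `A_f(α) p ≤ γ_f 𝟙`. -/
def broadFeasible (αsys γf : ℝ) {M : ℕ} (α : Fin M → ℝ) : Set ℝ :=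
  {v | v ∈ Set.Icc (0 : ℝ) 1 ∧ ∃ p ∈ stdSimplex ℝ (Fin M),
    (∀ k, (broadMatrix αsys α).mulVec p k ≤ v) ∧
    (∀ k, (focusedMatrix αsys α).mulVec p k ≤ γf)}

/-- The value `v_b(γ_f, α)` of the linear program. -/
noncomputable def vb (αsys γf : ℝ) {M : ℕ} (α : Fin M → ℝ) : ℝ :=
  sInf (broadFeasible αsys γf α)

/-- The objective values `v` of the feasible points `(p, v)` of the linear program for `v_f`:
`p ∈ Δ_M`, `v ∈ [0,1]`, `A_f(α) p ≤ v 𝟙`, `A_b(α) p ≤ γ_b 𝟙`. -/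
def focusedFeasible (αsys γb : ℝ) {M : ℕ} (α : Fin M → ℝ) : Set ℝ :=
  {v | v ∈ Set.Icc (0 : ℝ) 1 ∧ ∃ p ∈ stdSimplex ℝ (Fin M),
    (∀ k, (focusedMatrix αsys α).mulVec p k ≤ v) ∧
    (∀ k, (broadMatrix αsys α).mulVec p k ≤ γb)}

/-- The value `v_f(γ_b, α)` of the linear program. -/
noncomputable def vf (αsys γb : ℝ) {M : ℕ} (α : Fin M → ℝ) : ℝ :=
  sInf (focusedFeasible αsys γb α)

/-- The smallest gain `α_1` of an increasing gain vector. -/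
def firstGain {M : ℕ} (hM : 0 < M) (α : Fin M → ℝ) : ℝ := α ⟨0, hM⟩

/-- The largest gain `α_M` of an increasing gain vector. -/
def lastGain {M : ℕ} (hM : 0 < M) (α : Fin M → ℝ) : ℝ := α ⟨M - 1, Nat.sub_lt hM one_pos⟩

/-- The frontier `Par(α)`: the points `(v_f(γ_b, α), γ_b)` with `γ_b` between `R_b^*(α_M)` and
`R_b^*(α_1)`. -/
def frontier (αsys : ℝ) {M : ℕ} (hM : 0 < M) (α : Fin M → ℝ) : Set (ℝ × ℝ) :=
  {r | ∃ γb ∈ Set.Icc (worstBroadRisk αsys (lastGain hM α)) (worstBroadRisk αsys (firstGain hM α)),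
    r = (vf αsys γb α, γb)}

end CoordGame

namespace CoordGame

/-- `Φ` is an exact potential of the game with utilities `U`. -/
def IsExactPotential {N : ℕ} (U : Fin N → (Fin N → Action) → ℝ) (Φ : (Fin N → Action) → ℝ) :
    Prop :=
  ∀ i a z z', U i (Function.update a i z) - U i (Function.update a i z') =
    Φ (Function.update a i z) - Φ (Function.update a i z')

section LogLinear

variable {N : ℕ} {A : Fin N → Finset Action} {U : Fin N → (Fin N → Action) → ℝ}
  {Φ : (Fin N → Action) → ℝ}

theorem update_mem_piFinset {a : Fin N → Action} (ha : a ∈ Fintype.piFinset A) {i : Fin N}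
    {z : Action} (hz : z ∈ A i) : Function.update a i z ∈ Fintype.piFinset A := by
  rw [Fintype.mem_piFinset] at ha ⊢
  intro j
  by_cases h : j = i
  · subst h; simpa using hz
  · simpa [h] using ha j

theorem choiceProb_denom_pos {a : Fin N → Action} (ha : a ∈ Fintype.piFinset A) (β : ℝ)
    (i : Fin N) : 0 < ∑ z' ∈ A i, Real.exp (β * U i (Function.update a i z')) :=
  Finset.sum_pos (fun _ _ => Real.exp_pos _) ⟨a i, Fintype.mem_piFinset.mp ha i⟩

theorem choiceProb_pos {a : Fin N → Action} (ha : a ∈ Fintype.piFinset A) (β : ℝ)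
    (i : Fin N) (z : Action) : 0 < choiceProb A U β i a z :=
  div_pos (Real.exp_pos _) (choiceProb_denom_pos ha β i)

theorem sum_choiceProb {a : Fin N → Action} (ha : a ∈ Fintype.piFinset A) (β : ℝ) (i : Fin N) :
    ∑ z ∈ A i, choiceProb A U β i a z = 1 := by
  unfold choiceProb
  rw [← Finset.sum_div, div_self (choiceProb_denom_pos ha β i).ne']

/-- The transition kernel applied to a function. -/
theorem sum_transProb_mul {a : Fin N → Action} (ha : a ∈ Fintype.piFinset A) (β : ℝ)
    (f : (Fin N → Action) → ℝ) :
    ∑ b ∈ Fintype.piFinset A, transProb A U β a b * f b =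
      ∑ i : Fin N, (1 / (N : ℝ)) *
        ∑ z ∈ A i, choiceProb A U β i a z * f (Function.update a i z) := by
  unfold transProb
  simp_rw [Finset.sum_mul]
  rw [Finset.sum_comm]
  refine Finset.sum_congr rfl fun i _ => ?_
  simp_rw [mul_assoc, ← Finset.mul_sum, Finset.sum_mul]
  rw [Finset.sum_comm]
  congr 1
  refine Finset.sum_congr rfl fun z hz => ?_
  simp only [ite_mul, zero_mul]
  rw [Finset.sum_ite_eq, if_pos (update_mem_piFinset ha hz)]

theorem sum_transProb (hN : 0 < N) {a : Fin N → Action} (ha : a ∈ Fintype.piFinset A) (β : ℝ) :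
    ∑ b ∈ Fintype.piFinset A, transProb A U β a b = 1 := by
  have h := sum_transProb_mul (U := U) ha β (fun _ => 1)
  simp only [mul_one, sum_choiceProb ha] at h
  rw [h]
  have : (N : ℝ) ≠ 0 := by positivity
  simp [this]

theorem transProb_eq {a b : Fin N → Action} (hb : b ∈ Fintype.piFinset A) (β : ℝ) :
    transProb A U β a b = ∑ i : Fin N, (1 / (N : ℝ)) *
      if Function.update a i (b i) = b then choiceProb A U β i a (b i) else 0 := by
  unfold transProb
  refine Finset.sum_congr rfl fun i _ => ?_
  congr 1
  rw [Finset.sum_eq_single (b i)]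
  · intro z _ hz
    rw [if_neg]
    rintro rfl
    simp at hz
  · intro h
    exact absurd (Fintype.mem_piFinset.mp hb i) h

theorem detailed_balance (hU : IsExactPotential U Φ) {a b : Fin N → Action}
    (ha : a ∈ Fintype.piFinset A) (hb : b ∈ Fintype.piFinset A) (β : ℝ) :
    Real.exp (β * Φ a) * transProb A U β a b = Real.exp (β * Φ b) * transProb A U β b a := by
  rw [transProb_eq hb, transProb_eq ha, Finset.mul_sum, Finset.mul_sum]
  refine Finset.sum_congr rfl fun i _ => ?_
  by_cases h : Function.update a i (b i) = b
  · have h' : Function.update b i (a i) = a := by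
      rw [← h]; simp
    rw [if_pos h, if_pos h']
    unfold choiceProb
    have hd : ∀ z, Function.update b i z = Function.update a i z := by
      intro z; rw [← h]; simp
    simp_rw [hd]
    have h1 := hU i a (b i) (a i)
    rw [h, Function.update_eq_self] at h1 ⊢
    have h2 : Real.exp (β * Φ a) * Real.exp (β * U i b) =
        Real.exp (β * Φ b) * Real.exp (β * U i a) := by
      rw [← Real.exp_add, ← Real.exp_add]
      congr 1
      linear_combination β * h1
    linear_combination (1 / (N : ℝ)) / (∑ z' ∈ A i, Real.exp (β * U i (Function.update a i z'))) * h2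
  · have h' : Function.update b i (a i) ≠ a := by
      intro h'
      apply h
      rw [← h']; simp
    rw [if_neg h, if_neg h']
    simp

/-- The Gibbs distribution of a potential at inverse temperature `β`. -/
noncomputable def gibbs (A : Fin N → Finset Action) (Φ : (Fin N → Action) → ℝ) (β : ℝ)
    (a : Fin N → Action) : ℝ :=
  Real.exp (β * Φ a) / ∑ b ∈ Fintype.piFinset A, Real.exp (β * Φ b)

theorem isStationary_gibbs (hN : 0 < N) (hA : (Fintype.piFinset A).Nonempty)
    (hU : IsExactPotential U Φ) (β : ℝ) : IsStationary A U β (gibbs A Φ β) := by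
  have hZ : 0 < ∑ b ∈ Fintype.piFinset A, Real.exp (β * Φ b) :=
    Finset.sum_pos (fun _ _ => Real.exp_pos _) hA
  refine ⟨fun a _ => (div_pos (Real.exp_pos _) hZ).le, ?_, fun b hb => ?_⟩
  · unfold gibbs
    rw [← Finset.sum_div, div_self hZ.ne']
  · unfold gibbs
    simp_rw [div_mul_eq_mul_div]
    rw [← Finset.sum_div]
    congr 1
    rw [Finset.sum_congr rfl fun a ha => detailed_balance hU ha hb β, ← Finset.mul_sum,
      sum_transProb hN hb, mul_one]

/-- A stationary distribution of log-linear learning is proportional to the Gibbs weights. -/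
theorem IsStationary.mul_exp_eq (hN : 0 < N) (hU : IsExactPotential U Φ) {β : ℝ}
    {π : (Fin N → Action) → ℝ} (hπ : IsStationary A U β π) {a b : Fin N → Action}
    (ha : a ∈ Fintype.piFinset A) (hb : b ∈ Fintype.piFinset A) :
    π a * Real.exp (-(β * Φ a)) = π b * Real.exp (-(β * Φ b)) := by
  set h : (Fin N → Action) → ℝ := fun a => π a * Real.exp (-(β * Φ a)) with hh
  have hπh : ∀ a, π a = h a * Real.exp (β * Φ a) := by
    intro a; simp only [hh]
    rw [mul_assoc, ← Real.exp_add]; simp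
  have harm : ∀ b ∈ Fintype.piFinset A,
      ∑ a ∈ Fintype.piFinset A, transProb A U β b a * h a = h b := by
    intro b hb
    have h1 := hπ.2.2 b hb
    have h2 : ∑ a ∈ Fintype.piFinset A, π a * transProb A U β a b =
        Real.exp (β * Φ b) * ∑ a ∈ Fintype.piFinset A, transProb A U β b a * h a := by
      rw [Finset.mul_sum]
      refine Finset.sum_congr rfl fun a ha => ?_
      rw [hπh a]
      linear_combination h a * detailed_balance hU ha hb β
    rw [h2, hπh b, mul_comm] at h1
    exact mul_right_cancel₀ (Real.exp_pos _).ne' h1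
  obtain ⟨m, hm, hmax⟩ := Finset.exists_max_image (Fintype.piFinset A) h ⟨a, ha⟩
  have step : ∀ c ∈ Fintype.piFinset A, h c = h m → ∀ i, ∀ z ∈ A i,
      h (Function.update c i z) = h m := by
    intro c hc hcm i z hz
    have h1 : ∑ j : Fin N, (1 / (N : ℝ)) *
        ∑ z ∈ A j, choiceProb A U β j c z * (h m - h (Function.update c j z)) = 0 := by
      rw [← sum_transProb_mul hc β (fun b => h m - h b)]
      simp_rw [mul_sub]
      rw [Finset.sum_sub_distrib, ← Finset.sum_mul, sum_transProb hN hc, harm c hc, hcm]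
      ring
    have hNpos : (0 : ℝ) < 1 / N := by positivity
    have hnn : ∀ j, ∀ z ∈ A j,
        0 ≤ choiceProb A U β j c z * (h m - h (Function.update c j z)) := fun j z hz =>
      mul_nonneg (choiceProb_pos hc β j z).le (sub_nonneg.mpr (hmax _ (update_mem_piFinset hc hz)))
    rw [Finset.sum_eq_zero_iff_of_nonneg fun j _ =>
      mul_nonneg hNpos.le (Finset.sum_nonneg (hnn j))] at h1
    have h2 := (mul_eq_zero.mp (h1 i (Finset.mem_univ i))).resolve_left hNpos.ne'
    rw [Finset.sum_eq_zero_iff_of_nonneg (hnn i)] at h2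
    have h3 := (mul_eq_zero.mp (h2 z hz)).resolve_left (choiceProb_pos hc β i z).ne'
    linarith
  have key : ∀ c ∈ Fintype.piFinset A, h c = h m := by
    intro c hc
    have hs : ∀ s : Finset (Fin N), s.piecewise c m ∈ Fintype.piFinset A ∧
        h (s.piecewise c m) = h m := by
      intro s
      induction s using Finset.induction_on with
      | empty => simpa using hm
      | insert i s _ ih =>
        rw [Finset.piecewise_insert]
        have hci := Fintype.mem_piFinset.mp hc i
        exact ⟨update_mem_piFinset ih.1 hci, step _ ih.1 ih.2 i _ hci⟩
    simpa using (hs Finset.univ).2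
  exact (key a ha).trans (key b hb).symm

/-- Log-linear learning on an exact potential game selects the maximizers of the potential. -/
theorem mem_LLL_iff (hN : 0 < N) (hU : IsExactPotential U Φ) {a : Fin N → Action} :
    a ∈ LLL A U ↔ a ∈ Fintype.piFinset A ∧ ∀ b ∈ Fintype.piFinset A, Φ b ≤ Φ a := by
  constructor
  · rintro ⟨ha, π, hπ, c, hc, hlim⟩
    refine ⟨ha, fun b hb => ?_⟩
    by_contra! hlt
    have hzero : Tendsto (fun β : ℝ => Real.exp (-(β * (Φ b - Φ a)))) atTop (𝓝 0) :=
      Real.tendsto_exp_neg_atTop_nhds_zero.comp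
        (tendsto_id.atTop_mul_const (sub_pos.mpr hlt))
    have hle : ∀ᶠ β : ℝ in atTop, π β a ≤ Real.exp (-(β * (Φ b - Φ a))) := by
      filter_upwards [eventually_gt_atTop (0 : ℝ)] with β hβ
      have h1 := (hπ β hβ).mul_exp_eq hN hU ha hb
      have h2 : π β b ≤ 1 := by
        rw [← (hπ β hβ).2.1]
        exact Finset.single_le_sum (f := π β) (fun a ha => (hπ β hβ).1 a ha) hb
      have h3 : π β a = π β b * Real.exp (-(β * (Φ b - Φ a))) := by
        have h4 : Real.exp (-(β * (Φ b - Φ a))) =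
            Real.exp (-(β * Φ b)) * Real.exp (β * Φ a) := by
          rw [← Real.exp_add]; congr 1; ring
        rw [h4, ← mul_assoc, ← h1, mul_assoc, ← Real.exp_add]
        simp
      rw [h3]
      exact mul_le_of_le_one_left (Real.exp_pos _).le h2
    exact absurd (le_of_tendsto_of_tendsto hlim hzero hle) (not_le.mpr hc)
  · rintro ⟨ha, hmax⟩
    refine ⟨ha, gibbs A Φ, fun β _ => isStationary_gibbs hN ⟨a, ha⟩ hU β, ?_⟩
    have hterm : ∀ b ∈ Fintype.piFinset A,
        Tendsto (fun β : ℝ => Real.exp (-(β * (Φ a - Φ b)))) atTop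
          (𝓝 (if Φ b = Φ a then 1 else 0)) := by
      intro b hb
      split_ifs with h
      · simp [h]
      · exact Real.tendsto_exp_neg_atTop_nhds_zero.comp
          (tendsto_id.atTop_mul_const (sub_pos.mpr (lt_of_le_of_ne (hmax b hb) h)))
    have hsum := tendsto_finsetSum _ hterm
    have hpos : 0 < ∑ b ∈ Fintype.piFinset A, (if Φ b = Φ a then (1 : ℝ) else 0) :=
      Finset.sum_pos' (fun b _ => by split_ifs <;> norm_num) ⟨a, ha, by simp⟩
    refine ⟨_, inv_pos.mpr hpos, (hsum.inv₀ hpos.ne').congr fun β => ?_⟩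
    unfold gibbs
    rw [inv_eq_one_div, div_eq_div_iff (Finset.sum_pos (fun _ _ => Real.exp_pos _) ⟨a, ha⟩).ne'
      (Finset.sum_pos (fun _ _ => Real.exp_pos _) ⟨a, ha⟩).ne', one_mul, Finset.mul_sum]
    refine Finset.sum_congr rfl fun b _ => ?_
    rw [← Real.exp_add]
    congr 1
    ring

end LogLinear

theorem payoff_comm (α : ℝ) (z w : Action) : payoff α z w = payoff α w z := by
  cases z <;> cases w <;> rfl

theorem payoff_nonneg {α : ℝ} (hα : 0 < α) (z w : Action) : 0 ≤ payoff α z w := by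
  cases z <;> cases w <;> simp [payoff]
  linarith

theorem payoff_le {α : ℝ} (hα : 0 < α) (z w : Action) : payoff α z w ≤ 1 + α := by
  cases z <;> cases w <;> simp [payoff] <;> linarith

theorem payoff_mono {α α' : ℝ} (h : α ≤ α') (z w : Action) : payoff α z w ≤ payoff α' z w := by
  cases z <;> cases w <;> simp [payoff, h]

/-- Lowering the gain from `α` to `s` shrinks each payoff by at most the factor
`(1 + s) / (1 + α)`. -/
theorem payoff_scale {s α : ℝ} (hs : 0 < s) (h : s ≤ α) (z w : Action) :
    (1 + s) / (1 + α) * payoff α z w ≤ payoff s z w := by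
  have : (0 : ℝ) < 1 + α := by linarith
  cases z <;> cases w <;> simp [payoff]
  · field_simp; rfl
  · rw [div_le_one this]; linarith

section Welfare

variable {N : ℕ} (G : SimpleGraph (Fin N))

open Classical in
theorem welfare_eq (α : ℝ) (a : Fin N → Action) :
    welfare G α a = ∑ i, ∑ j, if G.Adj i j then payoff α (a i) (a j) else 0 := by
  simp [welfare, utility, Finset.sum_filter]

theorem welfare_nonneg {α : ℝ} (hα : 0 < α) (a : Fin N → Action) : 0 ≤ welfare G α a :=
  Finset.sum_nonneg fun _ _ => Finset.sum_nonneg fun _ _ => payoff_nonneg hα _ _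

theorem welfare_mono {α α' : ℝ} (h : α ≤ α') (a : Fin N → Action) :
    welfare G α a ≤ welfare G α' a :=
  Finset.sum_le_sum fun _ _ => Finset.sum_le_sum fun _ _ => payoff_mono h _ _

theorem welfare_scale {s α : ℝ} (hs : 0 < s) (h : s ≤ α) (a : Fin N → Action) :
    (1 + s) / (1 + α) * welfare G α a ≤ welfare G s a := by
  unfold welfare utility
  simp_rw [Finset.mul_sum]
  exact Finset.sum_le_sum fun _ _ => Finset.sum_le_sum fun _ _ => payoff_scale hs h _ _

theorem welfare_le_all_x {α : ℝ} (hα : 0 < α) (a : Fin N → Action) :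
    welfare G α a ≤ welfare G α (fun _ => .x) :=
  Finset.sum_le_sum fun _ _ => Finset.sum_le_sum fun _ _ => payoff_le hα _ _

theorem welfare_pos {α : ℝ} (hα : 0 < α) {a : Fin N → Action} {i j : Fin N} (hij : G.Adj i j)
    (ha : a i = a j) : 0 < welfare G α a := by
  classical
  refine Finset.sum_pos' (fun _ _ => Finset.sum_nonneg fun _ _ => payoff_nonneg hα _ _)
    ⟨i, Finset.mem_univ i, Finset.sum_pos' (fun _ _ => payoff_nonneg hα _ _) ⟨j, ?_, ?_⟩⟩
  · simpa using hij
  · rw [ha]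
    cases a j <;> simp [payoff]
    linarith

open Classical in
theorem welfare_split (α : ℝ) (i : Fin N) (a : Fin N → Action) :
    welfare G α a = 2 * utility G α i a +
      ∑ k ∈ Finset.univ.erase i, ∑ j ∈ Finset.univ.erase i,
        if G.Adj k j then payoff α (a k) (a j) else 0 := by
  have h1 : utility G α i a =
      ∑ k ∈ Finset.univ.erase i, if G.Adj i k then payoff α (a i) (a k) else 0 := by
    rw [utility, Finset.sum_filter, ← Finset.add_sum_erase _ _ (Finset.mem_univ i)]
    simp
  rw [welfare, ← Finset.add_sum_erase _ _ (Finset.mem_univ i), two_mul, add_assoc]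
  congr 1
  rw [h1, ← Finset.sum_add_distrib]
  refine Finset.sum_congr rfl fun k _ => ?_
  rw [utility, Finset.sum_filter, ← Finset.add_sum_erase _ _ (Finset.mem_univ i)]
  simp only [G.adj_comm k i, payoff_comm α (a k) (a i)]

theorem isExactPotential_utility (α : ℝ) :
    IsExactPotential (utility G α) (fun a => welfare G α a / 2) := by
  classical
  intro i a z z'
  simp only [welfare_split G α i]
  have h : ∀ z, (∑ k ∈ Finset.univ.erase i, ∑ j ∈ Finset.univ.erase i,
      if G.Adj k j then payoff α (Function.update a i z k) (Function.update a i z j) else 0) =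
      ∑ k ∈ Finset.univ.erase i, ∑ j ∈ Finset.univ.erase i,
        if G.Adj k j then payoff α (a k) (a j) else 0 := by
    intro z
    refine Finset.sum_congr rfl fun k hk => Finset.sum_congr rfl fun j hj => ?_
    rw [Function.update_of_ne (Finset.ne_of_mem_erase hk),
      Function.update_of_ne (Finset.ne_of_mem_erase hj)]
  rw [h z, h z']
  ring

/-- The payoff from the imposter of agent `i` when the agent plays `z`. -/
noncomputable def bonus (α : ℝ) (Sx Sy : Finset (Fin N)) (i : Fin N) (z : Action) : ℝ :=
  (if i ∈ Sy ∧ z = .y then 1 else 0) + (if i ∈ Sx ∧ z = .x then 1 + α else 0)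

/-- The potential of the game with imposters. -/
noncomputable def broadPotential (α : ℝ) (Sx Sy : Finset (Fin N)) (a : Fin N → Action) : ℝ :=
  welfare G α a / 2 + ∑ i, bonus α Sx Sy i (a i)

theorem isExactPotential_perceivedUtility (α : ℝ) (Sx Sy : Finset (Fin N)) :
    IsExactPotential (perceivedUtility G α Sx Sy) (broadPotential G α Sx Sy) := by
  intro i a z z'
  have h1 := isExactPotential_utility G α i a z z'
  have h2 : (∑ j, bonus α Sx Sy j (Function.update a i z j)) -
      ∑ j, bonus α Sx Sy j (Function.update a i z' j) =
      bonus α Sx Sy i z - bonus α Sx Sy i z' := by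
    rw [← Finset.sum_sub_distrib, Finset.sum_eq_single i]
    · simp
    · intro j _ hj
      simp [Function.update_of_ne hj]
    · simp
  have h3 : ∀ b, perceivedUtility G α Sx Sy i b = utility G α i b + bonus α Sx Sy i (b i) := by
    intro b; rw [perceivedUtility, bonus, add_assoc]
  simp only [h3, broadPotential, Function.update_self]
  simp only at h1
  linarith

end Welfare

section Efficiency

variable {N : ℕ} (G : SimpleGraph (Fin N)) {A : Fin N → Finset Action}
  {U : Fin N → (Fin N → Action) → ℝ} {Φ : (Fin N → Action) → ℝ} {αsys : ℝ}

theorem efficiency_le (hs : 0 < αsys) {a b : Fin N → Action} (ha : a ∈ LLL A U)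
    (hb : b ∈ Fintype.piFinset A) (hpos : 0 < welfare G αsys b) :
    efficiency G αsys A U ≤ welfare G αsys a / welfare G αsys b := by
  refine div_le_div₀ (welfare_nonneg G hs a) ?_ hpos ?_
  · refine csInf_le ⟨0, ?_⟩ ⟨a, ha, rfl⟩
    rintro _ ⟨c, -, rfl⟩
    exact welfare_nonneg G hs c
  · exact le_csSup ((Set.toFinite _).image _).bddAbove ⟨b, hb, rfl⟩

theorem exists_efficiency_eq (hN : 0 < N) (hU : IsExactPotential U Φ)
    (hA : (Fintype.piFinset A).Nonempty) :
    ∃ a ∈ LLL A U, ∃ b ∈ Fintype.piFinset A,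
      (∀ c ∈ Fintype.piFinset A, welfare G αsys c ≤ welfare G αsys b) ∧
      efficiency G αsys A U = welfare G αsys a / welfare G αsys b := by
  obtain ⟨m, hm, hmax⟩ := Finset.exists_max_image _ Φ hA
  have hne : (LLL A U).Nonempty := ⟨m, (mem_LLL_iff hN hU).mpr ⟨hm, hmax⟩⟩
  obtain ⟨a, ha, hae⟩ := (hne.image (welfare G αsys)).csInf_mem ((Set.toFinite _).image _)
  obtain ⟨b, hb, hbmax⟩ := Finset.exists_max_image _ (welfare G αsys) hA
  refine ⟨a, ha, b, hb, hbmax, ?_⟩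
  rw [efficiency, ← hae]
  congr 1
  refine IsGreatest.csSup_eq ⟨⟨b, hb, rfl⟩, ?_⟩
  rintro _ ⟨c, hc, rfl⟩
  exact hbmax c hc

theorem efficiency_mem_Icc (hN : 0 < N) (hs : 0 < αsys) (hU : IsExactPotential U Φ)
    (hA : (Fintype.piFinset A).Nonempty) : efficiency G αsys A U ∈ Set.Icc 0 1 := by
  obtain ⟨a, ha, b, hb, hmax, he⟩ := exists_efficiency_eq (αsys := αsys) G hN hU hA
  rw [he]
  exact ⟨div_nonneg (welfare_nonneg G hs a) (welfare_nonneg G hs b),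
    div_le_one_of_le₀ (hmax a ha.1) (welfare_nonneg G hs b)⟩

theorem fixedActions_nonempty (Fx Fy : Finset (Fin N)) :
    (Fintype.piFinset (fixedActions Fx Fy)).Nonempty := by
  rw [Fintype.piFinset_nonempty]
  intro i
  unfold fixedActions
  split_ifs
  · simp
  · simp
  · exact ⟨.x, Finset.mem_univ _⟩

theorem broadRisk_mem_Icc (hN : 0 < N) (hs : 0 < αsys) (α : ℝ) (Sx Sy : Finset (Fin N)) :
    broadRisk αsys α Sx Sy G ∈ Set.Icc 0 1 := by
  have h := efficiency_mem_Icc (A := fun _ => Finset.univ) G hN hs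
    (isExactPotential_perceivedUtility G α Sx Sy) ⟨fun _ => .x, by simp⟩
  rw [broadRisk]
  exact ⟨by linarith [h.2], by linarith [h.1]⟩

theorem focusedRisk_mem_Icc (hN : 0 < N) (hs : 0 < αsys) (α : ℝ) (Fx Fy : Finset (Fin N)) :
    focusedRisk αsys α Fx Fy G ∈ Set.Icc 0 1 := by
  have h := efficiency_mem_Icc G hN hs
    (isExactPotential_utility G α) (fixedActions_nonempty Fx Fy)
  rw [focusedRisk]
  exact ⟨by linarith [h.2], by linarith [h.1]⟩

theorem broadRisk_le_worst (hN : 3 ≤ N) (hs : 0 < αsys) (hG : G.Connected) (α : ℝ)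
    {Sx Sy : Finset (Fin N)} (hS : IsTargetSet Sx Sy) :
    broadRisk αsys α Sx Sy G ≤ worstBroadRisk αsys α := by
  refine le_csSup ⟨1, ?_⟩ ⟨N, G, Sx, Sy, hN, hG, hS, rfl⟩
  rintro _ ⟨n, H, Tx, Ty, hn, -, -, rfl⟩
  exact (broadRisk_mem_Icc H (by omega) hs α Tx Ty).2

theorem focusedRisk_le_worst (hN : 3 ≤ N) (hs : 0 < αsys) (hG : G.Connected) (α : ℝ)
    {Fx Fy : Finset (Fin N)} (hF : IsFixedSet Fx Fy) :
    focusedRisk αsys α Fx Fy G ≤ worstFocusedRisk αsys α := by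
  refine le_csSup ⟨1, ?_⟩ ⟨N, G, Fx, Fy, hN, hG, hF, rfl⟩
  rintro _ ⟨n, H, Tx, Ty, hn, -, -, rfl⟩
  exact (focusedRisk_mem_Icc H (by omega) hs α Tx Ty).2

end Efficiency

section WorstCase

variable {αsys : ℝ}

theorem isTargetSet_empty_univ (N : ℕ) : IsTargetSet (∅ : Finset (Fin N)) Finset.univ := by
  simp [IsTargetSet]

theorem isFixedSet_singleton {N : ℕ} (hN : 3 ≤ N) :
    IsFixedSet ({⟨0, by omega⟩} : Finset (Fin N)) ∅ := by
  refine ⟨by simp, by simp, fun h => ?_⟩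
  have := congrArg Finset.card h
  simp at this
  omega

theorem worstBroadRisk_mem_Icc (hs : 0 < αsys) (α : ℝ) :
    worstBroadRisk αsys α ∈ Set.Icc 0 1 := by
  constructor
  · exact (broadRisk_mem_Icc (⊤ : SimpleGraph (Fin 3)) (by omega) hs α _ _).1.trans
      (broadRisk_le_worst _ le_rfl hs SimpleGraph.connected_top α (isTargetSet_empty_univ 3))
  · refine csSup_le ⟨_, 3, ⊤, _, _, le_rfl, SimpleGraph.connected_top,
      isTargetSet_empty_univ 3, rfl⟩ ?_
    rintro _ ⟨n, H, Tx, Ty, hn, -, -, rfl⟩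
    exact (broadRisk_mem_Icc H (by omega) hs α Tx Ty).2

theorem worstFocusedRisk_mem_Icc (hs : 0 < αsys) (α : ℝ) :
    worstFocusedRisk αsys α ∈ Set.Icc 0 1 := by
  constructor
  · exact (focusedRisk_mem_Icc (⊤ : SimpleGraph (Fin 3)) (by omega) hs α _ _).1.trans
      (focusedRisk_le_worst _ le_rfl hs SimpleGraph.connected_top α (isFixedSet_singleton le_rfl))
  · refine csSup_le ⟨_, 3, ⊤, _, _, le_rfl, SimpleGraph.connected_top,
      isFixedSet_singleton le_rfl, rfl⟩ ?_
    rintro _ ⟨n, H, Tx, Ty, hn, -, -, rfl⟩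
    exact (focusedRisk_mem_Icc H (by omega) hs α Tx Ty).2

end WorstCase

section Star

theorem welfare_star (m : ℕ) (α : ℝ) (a : Fin (m + 1) → Action) :
    welfare (SimpleGraph.starGraph 0) α a = 2 * ∑ j : Fin m, payoff α (a 0) (a j.succ) := by
  classical
  rw [welfare_eq]
  simp only [Fin.sum_univ_succ, SimpleGraph.starGraph_adj]
  simp [Fin.succ_ne_zero, (Fin.succ_ne_zero _).symm, payoff_comm α _ (a 0), two_mul]

end Star

section Focused

variable {αsys : ℝ}

theorem exists_adj_of_connected {N : ℕ} (hN : 2 ≤ N) {G : SimpleGraph (Fin N)} (hG : G.Connected)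
    (i : Fin N) : ∃ j, G.Adj i j := by
  have : Nontrivial (Fin N) := Fin.nontrivial_iff_two_le.mpr hN
  exact hG.preconnected.exists_adj_of_nontrivial i

theorem focusedRisk_le (hs : 0 < αsys) {α : ℝ} (hα : αsys ≤ α) {N : ℕ} (hN : 3 ≤ N)
    {G : SimpleGraph (Fin N)} (hG : G.Connected) {Fx Fy : Finset (Fin N)}
    (hF : IsFixedSet Fx Fy) :
    focusedRisk αsys α Fx Fy G ≤ 1 - (1 + αsys) / (1 + α) := by
  obtain ⟨a, ha, b, hb, hbmax, he⟩ := exists_efficiency_eq (αsys := αsys) G (by omega)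
    (isExactPotential_utility G α) (fixedActions_nonempty Fx Fy)
  obtain ⟨i, hi⟩ : ∃ i, i ∉ Fx ∪ Fy := by
    by_contra! h
    exact hF.2.2 (Finset.eq_univ_iff_forall.mpr h)
  rw [Finset.notMem_union] at hi
  obtain ⟨j, hij⟩ := exists_adj_of_connected (by omega) hG i
  have hbpos : 0 < welfare G αsys b := by
    have hc : Function.update b i (b j) ∈ Fintype.piFinset (fixedActions Fx Fy) :=
      update_mem_piFinset hb (by simp [fixedActions, hi.1, hi.2])
    refine (welfare_pos G hs hij ?_).trans_le (hbmax _ hc)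
    simp [Function.update_of_ne hij.ne']
  have hab := ((mem_LLL_iff (by omega) (isExactPotential_utility G α)).mp ha).2 b hb
  have hr : 0 ≤ (1 + αsys) / (1 + α) := div_nonneg (by linarith) (by linarith)
  have h : (1 + αsys) / (1 + α) * welfare G αsys b ≤ welfare G αsys a :=
    calc _ ≤ (1 + αsys) / (1 + α) * welfare G α a :=
          mul_le_mul_of_nonneg_left ((welfare_mono G hα b).trans (by linarith)) hr
      _ ≤ _ := welfare_scale G hs hα a
  rw [focusedRisk, he]
  have := (le_div_iff₀ hbpos).mpr h
  linarith

/-- The profile on the star with `p + q` leaves in which the centre plays `z`, the first `p`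
leaves play `x` and the last `q` leaves play `y`. -/
def starProfile (p q : ℕ) (z : Action) : Fin (p + q + 1) → Action :=
  Fin.cons z (Fin.append (fun _ : Fin p => .x) (fun _ : Fin q => .y))

theorem welfare_starProfile_x (p q : ℕ) (α : ℝ) :
    welfare (SimpleGraph.starGraph 0) α (starProfile p q .x) = 2 * ((1 + α) * p) := by
  rw [welfare_star, Fin.sum_univ_add]
  simp [starProfile, payoff]
  ring

theorem welfare_starProfile_y (p q : ℕ) (α : ℝ) :
    welfare (SimpleGraph.starGraph 0) α (starProfile p q .y) = 2 * q := by
  rw [welfare_star, Fin.sum_univ_add]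
  simp [starProfile, payoff]

theorem le_worstFocusedRisk_of_star (hs : 0 < αsys) {α : ℝ} {p q : ℕ}
    (hp : 0 < p) (hq : 0 < q) (hpq : (q : ℝ) ≤ (1 + α) * p) :
    1 - (1 + αsys) * p / q ≤ worstFocusedRisk αsys α := by
  set Fx := Finset.univ.filter fun i : Fin (p + q + 1) => i ≠ 0 ∧ starProfile p q .x i = .x
    with hFx
  set Fy := Finset.univ.filter fun i : Fin (p + q + 1) => i ≠ 0 ∧ starProfile p q .x i = .y
    with hFy
  have hmx : ∀ i, i ∈ Fx ↔ i ≠ 0 ∧ starProfile p q .x i = .x := fun i => by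
    rw [hFx, Finset.mem_filter_univ]
  have hmy : ∀ i, i ∈ Fy ↔ i ≠ 0 ∧ starProfile p q .x i = .y := fun i => by
    rw [hFy, Finset.mem_filter_univ]
  have hmem : ∀ c, c ∈ Fintype.piFinset (fixedActions Fx Fy) ↔ ∃ z, c = starProfile p q z := by
    intro c
    rw [Fintype.mem_piFinset]
    have hfix : ∀ j : Fin (p + q), fixedActions Fx Fy j.succ =
        {Fin.append (fun _ : Fin p => Action.x) (fun _ : Fin q => .y) j} := by
      intro j
      cases h : Fin.append (fun _ : Fin p => Action.x) (fun _ : Fin q => .y) j <;>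
        simp [fixedActions, hmx, hmy, starProfile, h]
    have hfix0 : fixedActions Fx Fy 0 = Finset.univ := by simp [fixedActions, hmx, hmy]
    constructor
    · intro h
      refine ⟨c 0, funext fun i => ?_⟩
      refine Fin.cases (by simp [starProfile]) (fun j => ?_) i
      have := h j.succ
      rw [hfix, Finset.mem_singleton] at this
      simpa [starProfile] using this
    · rintro ⟨z, rfl⟩ i
      refine Fin.cases (by simp [hfix0]) (fun j => ?_) i
      rw [hfix]
      simp [starProfile]
  have hF : IsFixedSet Fx Fy := by
    refine ⟨?_, ⟨(⟨0, by omega⟩ : Fin (p + q)).succ, ?_⟩, fun h => ?_⟩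
    · rw [Finset.disjoint_left]
      intro i hi hi'
      exact absurd (((hmx i).mp hi).2.symm.trans ((hmy i).mp hi').2) (by simp)
    · rw [Finset.mem_union]
      cases h : starProfile p q .x (⟨0, by omega⟩ : Fin (p + q)).succ
      · exact Or.inl ((hmx _).mpr ⟨Fin.succ_ne_zero _, h⟩)
      · exact Or.inr ((hmy _).mpr ⟨Fin.succ_ne_zero _, h⟩)
    · have := Finset.mem_univ (0 : Fin (p + q + 1))
      rw [← h] at this
      simp [hmx, hmy] at this
  have hG := SimpleGraph.connected_starGraph (0 : Fin (p + q + 1))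
  refine le_trans ?_ (focusedRisk_le_worst _ (by omega) hs hG α hF)
  have ha : starProfile p q .x ∈
      LLL (fixedActions Fx Fy) (utility (SimpleGraph.starGraph 0) α) := by
    rw [mem_LLL_iff (by omega) (isExactPotential_utility _ α)]
    refine ⟨(hmem _).mpr ⟨_, rfl⟩, fun b hb => ?_⟩
    obtain ⟨z, rfl⟩ := (hmem b).mp hb
    cases z
    · exact le_rfl
    · rw [welfare_starProfile_x, welfare_starProfile_y]
      linarith
  have hqpos : (0 : ℝ) < q := by exact_mod_cast hq
  have he := efficiency_le (SimpleGraph.starGraph 0) hs ha ((hmem _).mpr ⟨.y, rfl⟩)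
    (by rw [welfare_starProfile_y]; positivity)
  rw [welfare_starProfile_x, welfare_starProfile_y, mul_div_mul_left _ _ two_ne_zero] at he
  rw [focusedRisk]
  linarith

/-- The worst-case risk from focused attacks is nondecreasing in the gain. -/
theorem monotoneOn_worstFocusedRisk (hs : 0 < αsys) :
    MonotoneOn (worstFocusedRisk αsys) (Set.Ici αsys) := by
  intro α hα α' hα' hle
  rcases hle.eq_or_lt with rfl | hlt
  · exact le_rfl
  have hα0 : 0 < α := hs.trans_le hα
  refine csSup_le ⟨_, 3, ⊤, _, _, le_rfl, SimpleGraph.connected_top,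
    isFixedSet_singleton le_rfl, rfl⟩ ?_
  rintro _ ⟨N, G, Fx, Fy, hN, hG, hF, rfl⟩
  refine (focusedRisk_le hs hα hN hG hF).trans ?_
  obtain ⟨r, hr1, hr2⟩ := exists_rat_btwn (show 1 + α < 1 + α' by linarith)
  have hr0 : 0 < r := by
    have : (0 : ℝ) < r := by linarith
    exact_mod_cast this
  have hq : 0 < r.num.toNat := by
    have := Rat.num_pos.mpr hr0
    omega
  have hd : (0 : ℝ) < r.den := by exact_mod_cast r.den_pos
  have hrq : (r : ℝ) = r.num.toNat / r.den := by
    rw [Rat.cast_def]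
    congr 1
    exact_mod_cast (Int.toNat_of_nonneg (Rat.num_pos.mpr hr0).le).symm
  have hq' : (0 : ℝ) < r.num.toNat := by exact_mod_cast hq
  refine le_trans ?_ (le_worstFocusedRisk_of_star hs r.den_pos hq ?_)
  · rw [hrq] at hr1
    have : (1 + αsys) * r.den / r.num.toNat ≤ (1 + αsys) / (1 + α) := by
      rw [div_le_div_iff₀ hq' (by linarith), mul_assoc]
      refine mul_le_mul_of_nonneg_left ?_ (by linarith)
      rw [lt_div_iff₀ hd] at hr1
      linarith
    linarith
  · rw [hrq, div_lt_iff₀ hd] at hr2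
    exact hr2.le

end Focused

section Cut

variable {N : ℕ} (G : SimpleGraph (Fin N))

open Classical in
/-- The number of pairs `(i, j) ∈ s × t` with `i` adjacent to `j`. -/
noncomputable def cut (s t : Finset (Fin N)) : ℝ :=
  ∑ i ∈ s, ∑ j ∈ t, if G.Adj i j then 1 else 0

theorem cut_comm (s t : Finset (Fin N)) : cut G s t = cut G t s := by
  unfold cut
  rw [Finset.sum_comm]
  exact Finset.sum_congr rfl fun i _ => Finset.sum_congr rfl fun j _ => by rw [G.adj_comm]

theorem cut_union_left {s s' : Finset (Fin N)} (h : Disjoint s s') (t : Finset (Fin N)) :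
    cut G (s ∪ s') t = cut G s t + cut G s' t :=
  Finset.sum_union h

theorem cut_union_right {s s' : Finset (Fin N)} (h : Disjoint s s') (t : Finset (Fin N)) :
    cut G t (s ∪ s') = cut G t s + cut G t s' := by
  rw [cut_comm, cut_union_left G h, cut_comm, cut_comm G s']

theorem cut_union_self {s t : Finset (Fin N)} (h : Disjoint s t) :
    cut G (s ∪ t) (s ∪ t) = cut G s s + 2 * cut G t s + cut G t t := by
  rw [cut_union_left G h, cut_union_right G h, cut_union_right G h, cut_comm G s t]
  ring

theorem cut_nonneg (s t : Finset (Fin N)) : 0 ≤ cut G s t :=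
  Finset.sum_nonneg fun _ _ => Finset.sum_nonneg fun _ _ => by split_ifs <;> norm_num

theorem exists_cut_eq_natCast (s t : Finset (Fin N)) : ∃ k : ℕ, cut G s t = k := by
  classical
  exact ⟨∑ i ∈ s, ∑ j ∈ t, if G.Adj i j then 1 else 0, by simp [cut]⟩

theorem cut_pos {s t : Finset (Fin N)} {i j : Fin N} (hi : i ∈ s) (hj : j ∈ t)
    (h : G.Adj i j) : 0 < cut G s t := by
  classical
  exact Finset.sum_pos' (fun _ _ => Finset.sum_nonneg fun _ _ => by split_ifs <;> norm_num)
    ⟨i, hi, Finset.sum_pos' (fun _ _ => by split_ifs <;> norm_num) ⟨j, hj, by simp [h]⟩⟩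

/-- The profile in which exactly the agents of `X` play `x`. -/
def xProfile (X : Finset (Fin N)) (i : Fin N) : Action := if i ∈ X then .x else .y

theorem exists_eq_xProfile (a : Fin N → Action) : ∃ X, a = xProfile X := by
  refine ⟨Finset.univ.filter fun i => a i = .x, funext fun i => ?_⟩
  cases h : a i <;> simp [xProfile, h]

theorem welfare_xProfile (α : ℝ) (X : Finset (Fin N)) :
    welfare G α (xProfile X) = (1 + α) * cut G X X + cut G Xᶜ Xᶜ := by
  classical
  have h : ∀ s : Finset (Fin N), cut G s s =
      ∑ i, ∑ j, if i ∈ s then if j ∈ s then if G.Adj i j then 1 else 0 else 0 else 0 := by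
    intro s
    simp [cut, Finset.sum_ite_mem]
  rw [welfare_eq, h, h, Finset.mul_sum, ← Finset.sum_add_distrib]
  refine Finset.sum_congr rfl fun i _ => ?_
  rw [Finset.mul_sum, ← Finset.sum_add_distrib]
  refine Finset.sum_congr rfl fun j _ => ?_
  by_cases hi : i ∈ X <;> by_cases hj : j ∈ X <;> by_cases hij : G.Adj i j <;>
    simp [hi, hj, hij, xProfile, payoff]

open Classical in
theorem sum_adj_eq_two_mul_card {V : Type*} [Fintype V] (K : SimpleGraph V) :
    ∑ v, ∑ w, (if K.Adj v w then (1 : ℝ) else 0) = 2 * (Nat.card K.edgeSet : ℝ) := by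
  have h := K.sum_degrees_eq_twice_card_edges
  rw [Nat.card_eq_fintype_card, ← SimpleGraph.edgeFinset_card]
  have h2 : ((∑ v, K.degree v : ℕ) : ℝ) = 2 * (K.edgeFinset.card : ℝ) := by
    rw [h]; push_cast; ring
  rw [← h2]
  push_cast
  refine Finset.sum_congr rfl fun v _ => ?_
  rw [← SimpleGraph.card_neighborFinset_eq_degree, SimpleGraph.neighborFinset_eq_filter]
  simp

/-- A connected set of vertices spans at least as many edges as a tree. -/
theorem exists_cut_self_eq {C : Finset (Fin N)} (hC : (G.induce (C : Set (Fin N))).Connected) :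
    ∃ e : ℕ, cut G C C = 2 * e ∧ C.card ≤ e + 1 := by
  classical
  refine ⟨Nat.card (G.induce (C : Set (Fin N))).edgeSet, ?_, ?_⟩
  · rw [← sum_adj_eq_two_mul_card]
    unfold cut
    rw [← Finset.sum_coe_sort C]
    refine Finset.sum_congr rfl fun v _ => ?_
    rw [← Finset.sum_coe_sort C]
    rfl
  · have := hC.card_vert_le_card_edgeSet_add_one
    simpa using this

end Cut

section Components

variable {N : ℕ} (G : SimpleGraph (Fin N))

/-- The graph `G` with all edges that meet `X` deleted. -/
def avoiding (X : Finset (Fin N)) : SimpleGraph (Fin N) where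
  Adj i j := G.Adj i j ∧ i ∉ X ∧ j ∉ X
  symm := ⟨fun _ _ h => ⟨h.1.symm, h.2.2, h.2.1⟩⟩
  loopless := ⟨fun _ h => h.1.ne rfl⟩

theorem notMem_of_reachable_avoiding {X : Finset (Fin N)} {v w : Fin N}
    (h : (avoiding G X).Reachable v w) (hv : v ∉ X) : w ∉ X := by
  obtain ⟨p⟩ := h
  induction p with
  | nil => exact hv
  | cons hadj _ ih => exact ih hadj.2.2

open Classical in
/-- The vertices of a component of `avoiding G X` that lie outside `X`. -/
noncomputable def componentOutside (X : Finset (Fin N)) (c : (avoiding G X).ConnectedComponent) :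
    Finset (Fin N) :=
  Xᶜ.filter fun v => (avoiding G X).connectedComponentMk v = c

open Classical in
theorem componentOutside_subset (X : Finset (Fin N)) (c : (avoiding G X).ConnectedComponent) :
    componentOutside G X c ⊆ Xᶜ :=
  Finset.filter_subset _ _

theorem componentOutside_closed {X : Finset (Fin N)} {c : (avoiding G X).ConnectedComponent}
    {v w : Fin N} (hv : v ∈ componentOutside G X c) (hw : w ∉ X) (h : G.Adj v w) :
    w ∈ componentOutside G X c := by
  simp only [componentOutside, Finset.mem_filter, Finset.mem_compl] at hv ⊢
  refine ⟨hw, ?_⟩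
  rw [← hv.2, SimpleGraph.ConnectedComponent.eq]
  exact (SimpleGraph.Adj.reachable (G := avoiding G X) ⟨h, hv.1, hw⟩).symm

theorem connected_componentOutside {X : Finset (Fin N)}
    {c : (avoiding G X).ConnectedComponent} (hc : (componentOutside G X c).Nonempty) :
    (G.induce (componentOutside G X c : Set (Fin N))).Connected := by
  obtain ⟨v, hv⟩ := hc
  simp only [componentOutside, Finset.mem_filter, Finset.mem_compl] at hv
  have hsupp : (componentOutside G X c : Set (Fin N)) = c.supp := by
    ext w
    simp only [componentOutside, Finset.coe_filter, Finset.mem_compl, Set.mem_ofPred_eq,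
      SimpleGraph.ConnectedComponent.mem_supp_iff, and_iff_right_iff_imp]
    intro hw
    refine notMem_of_reachable_avoiding G (SimpleGraph.ConnectedComponent.eq.mp ?_) hv.1
    rw [hv.2, hw]
  rw [hsupp]
  refine c.connected_toSimpleGraph.mono fun v w h => ?_
  exact (show (avoiding G X).Adj v w from h).1

open Classical in
theorem sum_cut_componentOutside (X t : Finset (Fin N)) :
    cut G Xᶜ t = ∑ c, cut G (componentOutside G X c) t := by
  exact (Finset.sum_fiberwise Xᶜ _ _).symm

theorem cut_componentOutside_compl (X : Finset (Fin N))
    (c : (avoiding G X).ConnectedComponent) :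
    cut G (componentOutside G X c) Xᶜ =
      cut G (componentOutside G X c) (componentOutside G X c) := by
  classical
  unfold cut
  refine Finset.sum_congr rfl fun v hv => (Finset.sum_subset (Finset.filter_subset _ _) ?_).symm
  intro w hw hw'
  rw [if_neg]
  exact fun h => hw' (componentOutside_closed G hv (Finset.mem_compl.mp hw) h)

end Components

/-- If a tree with `e` edges and `k` outgoing edges resists the gain `α`, so does a tree with
`e / k` edges and one outgoing edge. -/
theorem gain_mul_div_succ_le {α : ℝ} (hα : 0 < α) {e k : ℕ} (hk : 0 < k)
    (h : (1 + α) * (e + k) ≤ 2 * e + 1) : α * ((e / k : ℕ) + 1) ≤ (e / k : ℕ) := by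
  obtain ⟨r, hr, he⟩ : ∃ r, r < k ∧ e = k * (e / k) + r :=
    ⟨e % k, Nat.mod_lt e hk, (Nat.div_add_mod e k).symm⟩
  generalize e / k = n at he ⊢
  have hke : k ≤ e := by
    by_contra! hlt
    have h1 : (e : ℝ) + 1 ≤ k := by exact_mod_cast hlt
    have h2 : (0 : ℝ) ≤ e := Nat.cast_nonneg e
    nlinarith
  have hn : 1 ≤ n := by
    by_contra! h0
    have : n = 0 := by omega
    subst this
    omega
  have hn' : (1 : ℝ) ≤ n := by exact_mod_cast hn
  have hk' : (1 : ℝ) ≤ k := by exact_mod_cast hk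
  have hr' : (r : ℝ) + 1 ≤ k := by exact_mod_cast hr
  have he' : (e : ℝ) = k * n + r := by exact_mod_cast he
  have hr0 : (0 : ℝ) ≤ r := Nat.cast_nonneg r
  have hpos : (0 : ℝ) < e + k := by nlinarith
  have h1 : α * (e + k) ≤ e - k + 1 := by linarith
  have h2 : ((e : ℝ) - k + 1) * (n + 1) ≤ n * (e + k) := by
    rw [he']; nlinarith
  have h3 : (α * (n + 1)) * (e + k) ≤ n * (e + k) := by nlinarith
  exact le_of_mul_le_mul_right h3 hpos

/-- If no component outside `X` gains by switching to `x`, the edges outside `X` outnumber the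
edges leaving `X` by a factor `n` for which a star with `n + 1` edges resists the gain. -/
theorem exists_cut_ratio {N : ℕ} {G : SimpleGraph (Fin N)} (hG : G.Connected) {α : ℝ} (hα : 0 < α)
    {X : Finset (Fin N)} (hX : X.Nonempty) (hXc : Xᶜ.Nonempty)
    (hstable : ∀ C ⊆ Xᶜ, cut G C Xᶜ = cut G C C →
      (1 + α) * (cut G C X + cut G C C / 2) ≤ cut G C C / 2 + C.card) :
    ∃ n : ℕ, α * (n + 1) ≤ n ∧ 2 * n * cut G Xᶜ X ≤ cut G Xᶜ Xᶜ := by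
  have hcomp : ∀ c, cut G (componentOutside G X c) X = 0 ∨
      ∃ e k : ℕ, 0 < k ∧ cut G (componentOutside G X c) X = k ∧
        cut G (componentOutside G X c) Xᶜ = 2 * e ∧ α * ((e / k : ℕ) + 1) ≤ (e / k : ℕ) := by
    intro c
    obtain ⟨k, hk⟩ := exists_cut_eq_natCast G (componentOutside G X c) X
    rcases Nat.eq_zero_or_pos k with rfl | hk0
    · left; simpa using hk
    right
    have hne : (componentOutside G X c).Nonempty := by
      rw [Finset.nonempty_iff_ne_empty]
      intro h
      rw [h] at hk
      simp only [cut, Finset.sum_empty] at hk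
      have : (0 : ℝ) < k := by exact_mod_cast hk0
      linarith
    obtain ⟨e, he, hcard⟩ := exists_cut_self_eq G (connected_componentOutside G hne)
    have hcl := cut_componentOutside_compl G X c
    refine ⟨e, k, hk0, hk, hcl.trans he, gain_mul_div_succ_le hα hk0 ?_⟩
    have h := hstable _ (componentOutside_subset G X c) hcl
    rw [he, hk] at h
    have : ((componentOutside G X c).card : ℝ) ≤ e + 1 := by exact_mod_cast hcard
    linarith
  have hex : ∃ n : ℕ, α * (n + 1) ≤ n := by
    obtain ⟨v, hv⟩ := hXc
    obtain ⟨w, hw⟩ := hX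
    obtain ⟨p⟩ := hG.preconnected v w
    obtain ⟨d, -, hd1, hd2⟩ := p.exists_boundary_dart ((Xᶜ : Finset (Fin N)) : Set (Fin N))
      (by simpa using hv) (by simpa using hw)
    have hd2' : d.snd ∈ X := by simpa using hd2
    rcases hcomp ((avoiding G X).connectedComponentMk d.fst) with h | ⟨e, k, -, -, -, h⟩
    · refine absurd h (cut_pos G ?_ hd2' d.adj).ne'
      simpa [componentOutside] using hd1
    · exact ⟨_, h⟩
  classical
  refine ⟨Nat.find hex, Nat.find_spec hex, ?_⟩
  rw [sum_cut_componentOutside, sum_cut_componentOutside, Finset.mul_sum]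
  refine Finset.sum_le_sum fun c _ => ?_
  rcases hcomp c with h | ⟨e, k, hk, hkX, heX, h⟩
  · rw [h, mul_zero]
    exact cut_nonneg G _ _
  · have h1 : Nat.find hex * k ≤ e := (Nat.le_div_iff_mul_le hk).mp (Nat.find_min' hex h)
    have h2 : (Nat.find hex : ℝ) * k ≤ e := by exact_mod_cast h1
    rw [hkX, heX]
    linarith

section Broad

variable {αsys : ℝ}

theorem mem_LLL_perceivedUtility {N : ℕ} (hN : 0 < N) {G : SimpleGraph (Fin N)} {α : ℝ}
    {Sx Sy : Finset (Fin N)} {a : Fin N → Action} :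
    a ∈ LLL (fun _ => Finset.univ) (perceivedUtility G α Sx Sy) ↔
      ∀ b, broadPotential G α Sx Sy b ≤ broadPotential G α Sx Sy a := by
  rw [mem_LLL_iff hN (isExactPotential_perceivedUtility G α Sx Sy)]
  simp

theorem stable_of_maximizer {N : ℕ} {G : SimpleGraph (Fin N)} {α : ℝ} (hα : 0 < α)
    {Sx Sy X : Finset (Fin N)}
    (hmax : ∀ b, broadPotential G α Sx Sy b ≤ broadPotential G α Sx Sy (xProfile X))
    {C : Finset (Fin N)} (hC : C ⊆ Xᶜ) (hcl : cut G C Xᶜ = cut G C C) :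
    (1 + α) * (cut G C X + cut G C C / 2) ≤ cut G C C / 2 + C.card := by
  have hXC : Disjoint X C := by
    rw [Finset.disjoint_left]
    intro i hi hi'
    exact Finset.mem_compl.mp (hC hi') hi
  have h := hmax (xProfile (X ∪ C))
  have hbonus : ∑ i, bonus α Sx Sy i (xProfile X i) ≤
      ∑ i, bonus α Sx Sy i (xProfile (X ∪ C) i) + C.card := by
    have : (C.card : ℝ) = ∑ i, if i ∈ C then 1 else 0 := by simp
    rw [this, ← Finset.sum_add_distrib]
    refine Finset.sum_le_sum fun i _ => ?_
    by_cases hi : i ∈ C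
    · have hiX : i ∉ X := Finset.mem_compl.mp (hC hi)
      simp only [bonus, xProfile, hi, hiX, Finset.mem_union]
      simp
      split_ifs <;> linarith
    · simp [xProfile, hi]
  set Z := (X ∪ C)ᶜ with hZ
  have hCZ : Disjoint C Z := by
    rw [hZ, Finset.disjoint_left]
    intro i hi
    simp [hi]
  have hXc : Xᶜ = C ∪ Z := by
    ext i
    have := @hC i
    simp only [Finset.mem_compl] at this
    simp only [hZ, Finset.mem_compl, Finset.mem_union]
    tauto
  have hCZ0 : cut G Z C = 0 := by
    rw [hXc, cut_union_right G hCZ, cut_comm G C Z] at hcl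
    linarith
  simp only [broadPotential, welfare_xProfile] at h
  rw [← hZ, hXc, cut_union_self G hXC, cut_union_self G hCZ, hCZ0] at h
  linarith

theorem welfare_all_x_eq_cut {N : ℕ} (G : SimpleGraph (Fin N)) (α : ℝ) (X : Finset (Fin N)) :
    welfare G α (fun _ => .x) =
      (1 + α) * (cut G X X + 2 * cut G Xᶜ X + cut G Xᶜ Xᶜ) := by
  have h : (fun _ => .x) = xProfile (Finset.univ : Finset (Fin N)) := by
    funext i; simp [xProfile]
  rw [h, welfare_xProfile, ← cut_union_self G disjoint_compl_right]
  simp [cut]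

theorem welfare_all_x_pos {N : ℕ} (hN : 3 ≤ N) {G : SimpleGraph (Fin N)} (hG : G.Connected)
    {α : ℝ} (hα : 0 < α) : 0 < welfare G α (fun _ => .x) := by
  obtain ⟨j, hj⟩ := exists_adj_of_connected (by omega) hG (⟨0, by omega⟩ : Fin N)
  exact welfare_pos G hα hj rfl

/-- All agents playing `y` stays selected when every agent gets a `y`-imposter and the gain is
lowered. -/
theorem all_y_maximizer {N : ℕ} {G : SimpleGraph (Fin N)} {α α' : ℝ} (hle : α ≤ α')
    (hα' : 0 < α') {Sx Sy : Finset (Fin N)}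
    (hmax : ∀ b, broadPotential G α' Sx Sy b ≤ broadPotential G α' Sx Sy (fun _ => .y))
    (b : Fin N → Action) :
    broadPotential G α ∅ Finset.univ b ≤ broadPotential G α ∅ Finset.univ (fun _ => .y) := by
  have h1 := hmax b
  have h2 := welfare_mono G hle b
  have h3 : welfare G α (fun _ => .y) = welfare G α' (fun _ => .y) := by
    simp [welfare, utility, payoff]
  have h4 : ∑ i, bonus α' Sx Sy i .y + ∑ i, bonus α ∅ Finset.univ i (b i) ≤
      ∑ i, bonus α' Sx Sy i (b i) + ∑ i, bonus α ∅ (Finset.univ : Finset (Fin N)) i .y := by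
    rw [← Finset.sum_add_distrib, ← Finset.sum_add_distrib]
    refine Finset.sum_le_sum fun i _ => ?_
    cases b i <;> simp [bonus] <;> split_ifs <;> linarith
  simp only [broadPotential] at h1 ⊢
  linarith

/-- The profile on the star in which one leaf plays `x` and all other agents play `y`. -/
def oneLeafX (n : ℕ) : Fin (n + 2) → Action := fun i => if i = 1 then .x else .y

theorem oneLeafX_maximizer {α : ℝ} (hα : 0 < α) {n : ℕ} (hn : α * (n + 1) ≤ n)
    (b : Fin (n + 2) → Action) :
    broadPotential (SimpleGraph.starGraph 0) α {1} {1}ᶜ b ≤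
      broadPotential (SimpleGraph.starGraph 0) α {1} {1}ᶜ (oneLeafX n) := by
  have hpot : ∀ c : Fin (n + 2) → Action,
      broadPotential (SimpleGraph.starGraph 0) α {1} {1}ᶜ c =
        (if c 0 = .y then 1 else 0) + (payoff α (c 0) (c 1) + if c 1 = .x then 1 + α else 0) +
        ∑ j : Fin n, (payoff α (c 0) (c j.succ.succ) + if c j.succ.succ = .y then 1 else 0) := by
    intro c
    rw [broadPotential, welfare_star, Fin.sum_univ_succ, Fin.sum_univ_succ (n := n + 1),
      Fin.sum_univ_succ (n := n), Finset.sum_add_distrib]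
    have h : ∀ j : Fin n, j.succ.succ ≠ (1 : Fin (n + 2)) := by
      intro j h
      rw [Fin.ext_iff] at h
      simp at h
    simp [bonus, h]
    ring
  rw [hpot, hpot]
  have hval : ∑ j : Fin n, (payoff α (oneLeafX n 0) (oneLeafX n j.succ.succ) +
      if oneLeafX n j.succ.succ = .y then 1 else 0) = n * 2 := by
    have h : ∀ j : Fin n, j.succ.succ ≠ (1 : Fin (n + 2)) := by
      intro j h
      rw [Fin.ext_iff] at h
      simp at h
    simp [oneLeafX, h, payoff]
    ring
  rw [hval]
  have h1 : oneLeafX n 1 = .x := by simp [oneLeafX]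
  have h0 : oneLeafX n 0 = .y := by simp [oneLeafX]
  rw [h0, h1]
  have hn0 : (0 : ℝ) ≤ n := Nat.cast_nonneg n
  have hb1 : payoff α (b 0) (b 1) + (if b 1 = .x then 1 + α else 0) ≤
      if b 0 = .x then 2 * (1 + α) else 1 + α := by
    cases b 0 <;> cases b 1 <;> simp [payoff] <;> linarith
  have hb2 : ∑ j : Fin n, (payoff α (b 0) (b j.succ.succ) +
      if b j.succ.succ = .y then 1 else 0) ≤ n * (if b 0 = .x then 1 + α else 2) := by
    have : (n : ℝ) * (if b 0 = .x then 1 + α else 2) =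
        ∑ _j : Fin n, if b 0 = .x then 1 + α else 2 := by
      rw [Finset.sum_const, Finset.card_univ, Fintype.card_fin, nsmul_eq_mul]
    rw [this]
    refine Finset.sum_le_sum fun j _ => ?_
    cases b 0 <;> cases b j.succ.succ <;> simp [payoff] <;> linarith
  cases hb0 : b 0 <;> simp only [hb0] at hb1 hb2 ⊢ <;> simp [payoff] at hb1 hb2 ⊢ <;> nlinarith

theorem le_worstBroadRisk_of_star (hs : 0 < αsys) {α : ℝ} (hα : 0 < α) {n : ℕ}
    (hn : α * (n + 1) ≤ n) :
    1 - n / ((1 + αsys) * (n + 1)) ≤ worstBroadRisk αsys α := by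
  have hn1 : 1 ≤ n := by
    by_contra! h
    have : n = 0 := by omega
    subst this
    simp at hn
    linarith
  have hS : IsTargetSet ({1} : Finset (Fin (n + 2))) {1}ᶜ :=
    ⟨disjoint_compl_right, Finset.union_compl _⟩
  have hG := SimpleGraph.connected_starGraph (0 : Fin (n + 2))
  refine le_trans ?_ (broadRisk_le_worst _ (by omega) hs hG α hS)
  have h := efficiency_le _ hs ((mem_LLL_perceivedUtility (by omega)).mpr
    (oneLeafX_maximizer hα hn)) (b := fun _ => .x) (by simp)
    (welfare_all_x_pos (by omega) hG hs)
  have h1 : welfare (SimpleGraph.starGraph 0) αsys (oneLeafX n) = 2 * n := by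
    rw [welfare_star, Fin.sum_univ_succ]
    have h : ∀ j : Fin n, j.succ.succ ≠ (1 : Fin (n + 2)) := by
      intro j h
      rw [Fin.ext_iff] at h
      simp at h
    simp [oneLeafX, h, payoff]
  have h2 : welfare (SimpleGraph.starGraph (0 : Fin (n + 2))) αsys (fun _ => .x) =
      2 * ((1 + αsys) * (n + 1)) := by
    rw [welfare_star]
    simp [payoff]
    ring
  rw [h1, h2, mul_div_mul_left _ _ two_ne_zero] at h
  rw [broadRisk]
  linarith

/-- The worst-case risk from broad attacks is nonincreasing in the gain. -/
theorem antitoneOn_worstBroadRisk (hs : 0 < αsys) :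
    AntitoneOn (worstBroadRisk αsys) (Set.Ioi 0) := by
  intro α hα α' hα' hle
  simp only [Set.mem_Ioi] at hα hα'
  refine csSup_le ⟨_, 3, ⊤, _, _, le_rfl, SimpleGraph.connected_top,
    isTargetSet_empty_univ 3, rfl⟩ ?_
  rintro _ ⟨N, G, Sx, Sy, hN, hG, -, rfl⟩
  obtain ⟨a, ha, b, -, hbmax, he⟩ := exists_efficiency_eq (αsys := αsys)
    (A := fun _ => Finset.univ) G (by omega)
    (isExactPotential_perceivedUtility G α' Sx Sy) ⟨fun _ => .x, by simp⟩
  have hb : welfare G αsys b = welfare G αsys (fun _ => .x) :=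
    le_antisymm (welfare_le_all_x G hs b) (hbmax _ (by simp))
  have hpos := welfare_all_x_pos hN hG hs
  rw [mem_LLL_perceivedUtility (by omega)] at ha
  obtain ⟨X, rfl⟩ := exists_eq_xProfile a
  rw [broadRisk, he, hb]
  rcases Finset.eq_empty_or_nonempty Xᶜ with hXc | hXc
  · have : xProfile X = fun _ => .x := by
      rw [Finset.compl_eq_empty_iff] at hXc
      subst hXc
      funext i; simp [xProfile]
    rw [this, div_self hpos.ne', sub_self]
    exact (worstBroadRisk_mem_Icc hs α).1
  rcases Finset.eq_empty_or_nonempty X with rfl | hX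
  · have hy : xProfile (∅ : Finset (Fin N)) = fun _ => .y := by
      funext i; simp [xProfile]
    rw [hy] at ha ⊢
    refine le_trans ?_ (broadRisk_le_worst G hN hs hG α (isTargetSet_empty_univ N))
    have h := efficiency_le G hs ((mem_LLL_perceivedUtility (by omega)).mpr
      (all_y_maximizer hle hα' ha)) (b := fun _ => .x) (by simp) hpos
    rw [broadRisk]
    linarith
  · obtain ⟨n, hn, hcut⟩ := exists_cut_ratio hG hα' hX hXc
      fun C hC hcl => stable_of_maximizer hα' ha hC hcl
    have hn' : α * (n + 1) ≤ n :=
      (mul_le_mul_of_nonneg_right hle (by positivity)).trans hn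
    refine le_trans ?_ (le_worstBroadRisk_of_star hs hα hn')
    rw [sub_le_sub_iff_left, div_le_div_iff₀ (by positivity) hpos, welfare_xProfile,
      welfare_all_x_eq_cut G αsys X]
    have h1 := cut_nonneg G X X
    have h2 := cut_nonneg G Xᶜ Xᶜ
    have hn0 : (0 : ℝ) ≤ n := Nat.cast_nonneg n
    have h3 : (n : ℝ) * (cut G X X + 2 * cut G Xᶜ X + cut G Xᶜ Xᶜ) ≤
        ((1 + αsys) * cut G X X + cut G Xᶜ Xᶜ) * (n + 1) := by
      nlinarith [mul_nonneg hs.le h1, mul_nonneg (mul_nonneg hs.le h1) hn0]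
    calc _ = (1 + αsys) * ((n : ℝ) * (cut G X X + 2 * cut G Xᶜ X + cut G Xᶜ Xᶜ)) := by ring
      _ ≤ (1 + αsys) * (((1 + αsys) * cut G X X + cut G Xᶜ Xᶜ) * (n + 1)) :=
          mul_le_mul_of_nonneg_left h3 (by linarith)
      _ = _ := by ring

end Broad

section LinearProgram

/-- The objective values of a two-matrix game with side constraint form a compact set. -/
theorem isCompact_feasible {M : ℕ} (A B : Matrix (Fin M) (Fin M) ℝ) (γ : ℝ) :
    IsCompact {v : ℝ | v ∈ Set.Icc (0 : ℝ) 1 ∧ ∃ p ∈ stdSimplex ℝ (Fin M),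
      (∀ k, A.mulVec p k ≤ v) ∧ ∀ k, B.mulVec p k ≤ γ} := by
  have hK : IsCompact ((Set.Icc (0 : ℝ) 1 ×ˢ stdSimplex ℝ (Fin M)) ∩
      {x : ℝ × (Fin M → ℝ) | (∀ k, A.mulVec x.2 k ≤ x.1) ∧ ∀ k, B.mulVec x.2 k ≤ γ}) := by
    refine (isCompact_Icc.prod (isCompact_stdSimplex ..)).inter_right ?_
    have hA : ∀ (A : Matrix (Fin M) (Fin M) ℝ) (k : Fin M),
        Continuous fun x : ℝ × (Fin M → ℝ) => A.mulVec x.2 k := by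
      intro A k
      simp only [Matrix.mulVec, dotProduct]
      fun_prop
    simp only [Set.ofPred_and, Set.ofPred_forall]
    exact (isClosed_iInter fun k => isClosed_le (hA A k) continuous_fst).inter
      (isClosed_iInter fun k => isClosed_le (hA B k) continuous_const)
  convert hK.image continuous_fst using 1
  ext v
  constructor
  · rintro ⟨hv, p, hp, h⟩
    exact ⟨(v, p), ⟨⟨hv, hp⟩, h⟩, rfl⟩
  · rintro ⟨⟨v, p⟩, ⟨⟨hv, hp⟩, h⟩, rfl⟩
    exact ⟨hv, p, hp, h⟩

variable {M M' : ℕ}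

/-- The distribution `p` carried over along `e`. -/
def pushforward (e : Fin M → Fin M') (p : Fin M → ℝ) (j' : Fin M') : ℝ :=
  ∑ j, if e j = j' then p j else 0

theorem sum_pushforward (e : Fin M → Fin M') (p : Fin M → ℝ) (s : Finset (Fin M')) :
    ∑ j' ∈ s, pushforward e p j' = ∑ j with e j ∈ s, p j := by
  unfold pushforward
  rw [Finset.sum_comm, Finset.sum_filter]
  exact Finset.sum_congr rfl fun j _ => by simp

theorem pushforward_mem_stdSimplex (e : Fin M → Fin M') {p : Fin M → ℝ}
    (hp : p ∈ stdSimplex ℝ (Fin M)) : pushforward e p ∈ stdSimplex ℝ (Fin M') := by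
  refine ⟨fun j' => Finset.sum_nonneg fun j _ => ?_, ?_⟩
  · split_ifs
    · exact hp.1 j
    · exact le_rfl
  · rw [sum_pushforward, ← hp.2]
    simp

theorem broadMatrix_mulVec (αsys : ℝ) (α p : Fin M → ℝ) (k : Fin M) :
    (broadMatrix αsys α).mulVec p k =
      worstBroadRisk αsys (α k) * ∑ j with j ≤ k, p j := by
  simp [broadMatrix, Matrix.mulVec, dotProduct, Finset.sum_filter, Finset.mul_sum]

theorem focusedMatrix_mulVec (αsys : ℝ) (α p : Fin M → ℝ) (k : Fin M) :
    (focusedMatrix αsys α).mulVec p k =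
      worstFocusedRisk αsys (α k) * ∑ j with k ≤ j, p j := by
  simp [focusedMatrix, Matrix.mulVec, dotProduct, Finset.sum_filter, Finset.mul_sum]

variable {αsys : ℝ} {α : Fin M → ℝ} {α' : Fin M' → ℝ} {e : Fin M → Fin M'}

theorem broadMatrix_pushforward_le (hs : 0 < αsys) (he : StrictMono e)
    (heα : ∀ j, α' (e j) = α j) (hα' : StrictMono α') (hα'sys : ∀ j, αsys ≤ α' j)
    {p : Fin M → ℝ} (hp : ∀ j, 0 ≤ p j) {v : ℝ} (hv : 0 ≤ v)
    (h : ∀ k, (broadMatrix αsys α).mulVec p k ≤ v) (k' : Fin M') :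
    (broadMatrix αsys α').mulVec (pushforward e p) k' ≤ v := by
  rw [broadMatrix_mulVec, sum_pushforward]
  simp only [Finset.mem_filter, Finset.mem_univ, true_and]
  rcases (Finset.univ.filter fun j => e j ≤ k').eq_empty_or_nonempty with h0 | hne
  · simpa [h0] using hv
  · obtain ⟨k, hk, hkmax⟩ := Finset.exists_max_image _ id hne
    simp only [Finset.mem_filter, Finset.mem_univ, true_and, id] at hk hkmax
    have hset : (Finset.univ.filter fun j => e j ≤ k') = Finset.univ.filter fun j => j ≤ k := by
      ext j
      simp only [Finset.mem_filter, Finset.mem_univ, true_and]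
      exact ⟨hkmax j, fun hj => (he.monotone hj).trans hk⟩
    rw [hset]
    refine le_trans ?_ (h k)
    rw [broadMatrix_mulVec, ← heα k]
    exact mul_le_mul_of_nonneg_right (antitoneOn_worstBroadRisk hs (hs.trans_le (hα'sys _))
      (hs.trans_le (hα'sys _)) (hα'.monotone hk)) (Finset.sum_nonneg fun j _ => hp j)

theorem focusedMatrix_pushforward_le (hs : 0 < αsys) (he : StrictMono e)
    (heα : ∀ j, α' (e j) = α j) (hα' : StrictMono α') (hα'sys : ∀ j, αsys ≤ α' j)
    {p : Fin M → ℝ} (hp : ∀ j, 0 ≤ p j) {v : ℝ} (hv : 0 ≤ v)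
    (h : ∀ k, (focusedMatrix αsys α).mulVec p k ≤ v) (k' : Fin M') :
    (focusedMatrix αsys α').mulVec (pushforward e p) k' ≤ v := by
  rw [focusedMatrix_mulVec, sum_pushforward]
  simp only [Finset.mem_filter, Finset.mem_univ, true_and]
  rcases (Finset.univ.filter fun j => k' ≤ e j).eq_empty_or_nonempty with h0 | hne
  · simpa [h0] using hv
  · obtain ⟨k, hk, hkmin⟩ := Finset.exists_min_image _ id hne
    simp only [Finset.mem_filter, Finset.mem_univ, true_and, id] at hk hkmin
    have hset : (Finset.univ.filter fun j => k' ≤ e j) = Finset.univ.filter fun j => k ≤ j := by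
      ext j
      simp only [Finset.mem_filter, Finset.mem_univ, true_and]
      exact ⟨hkmin j, fun hj => hk.trans (he.monotone hj)⟩
    rw [hset]
    refine le_trans ?_ (h k)
    rw [focusedMatrix_mulVec, ← heα k]
    exact mul_le_mul_of_nonneg_right (monotoneOn_worstFocusedRisk hs (hα'sys _) (hα'sys _)
      (hα'.monotone hk)) (Finset.sum_nonneg fun j _ => hp j)

theorem focusedFeasible_subset (hs : 0 < αsys) (he : StrictMono e)
    (heα : ∀ j, α' (e j) = α j) (hα' : StrictMono α') (hα'sys : ∀ j, αsys ≤ α' j)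
    {γ : ℝ} (hγ : 0 ≤ γ) : focusedFeasible αsys γ α ⊆ focusedFeasible αsys γ α' := by
  rintro v ⟨hv, p, hp, h1, h2⟩
  exact ⟨hv, _, pushforward_mem_stdSimplex e hp,
    focusedMatrix_pushforward_le hs he heα hα' hα'sys hp.1 hv.1 h1,
    broadMatrix_pushforward_le hs he heα hα' hα'sys hp.1 hγ h2⟩

theorem broadFeasible_subset (hs : 0 < αsys) (he : StrictMono e)
    (heα : ∀ j, α' (e j) = α j) (hα' : StrictMono α') (hα'sys : ∀ j, αsys ≤ α' j)
    {γ : ℝ} (hγ : 0 ≤ γ) : broadFeasible αsys γ α ⊆ broadFeasible αsys γ α' := by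
  rintro v ⟨hv, p, hp, h1, h2⟩
  exact ⟨hv, _, pushforward_mem_stdSimplex e hp,
    broadMatrix_pushforward_le hs he heα hα' hα'sys hp.1 hv.1 h1,
    focusedMatrix_pushforward_le hs he heα hα' hα'sys hp.1 hγ h2⟩

theorem sum_le_one {p : Fin M → ℝ} (hp : p ∈ stdSimplex ℝ (Fin M)) (s : Finset (Fin M)) :
    ∑ j ∈ s, p j ≤ 1 := by
  rw [← hp.2]
  exact Finset.sum_le_sum_of_subset_of_nonneg (Finset.subset_univ s) fun j _ _ => hp.1 j

theorem one_mem_focusedFeasible (hs : 0 < αsys) (hM : 0 < M) {γ : ℝ} (hγ : 0 ≤ γ)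
    (h : worstBroadRisk αsys (lastGain hM α) ≤ γ) : 1 ∈ focusedFeasible αsys γ α := by
  have hp := single_mem_stdSimplex ℝ (⟨M - 1, Nat.sub_lt hM one_pos⟩ : Fin M)
  refine ⟨by simp, _, hp, fun k => ?_, fun k => ?_⟩
  · rw [focusedMatrix_mulVec]
    have h1 := worstFocusedRisk_mem_Icc hs (α k)
    exact mul_le_one₀ h1.2 (Finset.sum_nonneg fun j _ => hp.1 j) (sum_le_one hp _)
  · rw [broadMatrix_mulVec]
    by_cases hk : k = ⟨M - 1, Nat.sub_lt hM one_pos⟩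
    · rw [hk]
      exact (mul_le_of_le_one_right (worstBroadRisk_mem_Icc hs _).1 (sum_le_one hp _)).trans h
    · rw [Finset.sum_eq_zero, mul_zero]
      · exact hγ
      · intro j hj
        simp only [Finset.mem_filter, Finset.mem_univ, true_and] at hj
        refine Pi.single_eq_of_ne ?_ _
        rintro rfl
        apply hk
        rw [Fin.le_def] at hj
        rw [Fin.ext_iff]
        have := k.isLt
        simp only at hj ⊢
        omega

theorem one_mem_broadFeasible (hs : 0 < αsys) (hM : 0 < M) {γ : ℝ} (hγ : 0 ≤ γ)
    (h : worstFocusedRisk αsys (firstGain hM α) ≤ γ) : 1 ∈ broadFeasible αsys γ α := by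
  have hp := single_mem_stdSimplex ℝ (⟨0, hM⟩ : Fin M)
  refine ⟨by simp, _, hp, fun k => ?_, fun k => ?_⟩
  · rw [broadMatrix_mulVec]
    have h1 := worstBroadRisk_mem_Icc hs (α k)
    exact mul_le_one₀ h1.2 (Finset.sum_nonneg fun j _ => hp.1 j) (sum_le_one hp _)
  · rw [focusedMatrix_mulVec]
    by_cases hk : k = ⟨0, hM⟩
    · rw [hk]
      exact (mul_le_of_le_one_right (worstFocusedRisk_mem_Icc hs _).1 (sum_le_one hp _)).trans h
    · rw [Finset.sum_eq_zero, mul_zero]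
      · exact hγ
      · intro j hj
        simp only [Finset.mem_filter, Finset.mem_univ, true_and] at hj
        refine Pi.single_eq_of_ne ?_ _
        rintro rfl
        apply hk
        rw [Fin.le_def] at hj
        rw [Fin.ext_iff]
        simp only at hj ⊢
        omega

end LinearProgram

end CoordGame

theorem claim2 (αsys : ℝ) (hsys : 0 < αsys) (M M' : ℕ) (hM : 0 < M) (hM' : 0 < M')
    (hMM' : M < M') (α : Fin M → ℝ) (α' : Fin M' → ℝ) (hα : StrictMono α) (hα' : StrictMono α')
    (hα'sys : ∀ j, αsys ≤ α' j) (hsub : Set.range α ⊆ Set.range α') :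
    (∀ γb ∈ Set.Icc (CoordGame.worstBroadRisk αsys (CoordGame.lastGain hM α)) 1,
      IsLeast (CoordGame.focusedFeasible αsys γb α) (CoordGame.vf αsys γb α) ∧
      IsLeast (CoordGame.focusedFeasible αsys γb α') (CoordGame.vf αsys γb α') ∧
      CoordGame.vf αsys γb α' ≤ CoordGame.vf αsys γb α) ∧
    (∀ γf ∈ Set.Icc (CoordGame.worstFocusedRisk αsys (CoordGame.firstGain hM α)) 1,
      IsLeast (CoordGame.broadFeasible αsys γf α) (CoordGame.vb αsys γf α) ∧
      IsLeast (CoordGame.broadFeasible αsys γf α') (CoordGame.vb αsys γf α') ∧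
      CoordGame.vb αsys γf α' ≤ CoordGame.vb αsys γf α) ∧
    (∀ r ∈ CoordGame.frontier αsys hM α, ∃ r' ∈ CoordGame.frontier αsys hM' α', r' ≤ r) := by
  open CoordGame in
  choose e heα using fun j => hsub (Set.mem_range_self j)
  have he : StrictMono e := fun i j hij => by
    rw [← hα'.lt_iff_lt, heα, heα]
    exact hα hij
  have part1 : ∀ γb ∈ Set.Icc (worstBroadRisk αsys (lastGain hM α)) 1,
      IsLeast (focusedFeasible αsys γb α) (vf αsys γb α) ∧
      IsLeast (focusedFeasible αsys γb α') (vf αsys γb α') ∧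
      vf αsys γb α' ≤ vf αsys γb α := by
    intro γ hγ
    have hγ0 : 0 ≤ γ := (worstBroadRisk_mem_Icc hsys _).1.trans hγ.1
    have hsubset := focusedFeasible_subset hsys he heα hα' hα'sys hγ0
    have h1 := one_mem_focusedFeasible hsys hM hγ0 hγ.1
    have hl := (isCompact_feasible (focusedMatrix αsys α) (broadMatrix αsys α) γ).isLeast_sInf
      ⟨1, h1⟩
    have hl' := (isCompact_feasible (focusedMatrix αsys α') (broadMatrix αsys α') γ).isLeast_sInf
      ⟨1, hsubset h1⟩
    exact ⟨hl, hl', hl'.2 (hsubset hl.1)⟩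
  refine ⟨part1, ?_, ?_⟩
  · intro γ hγ
    have hγ0 : 0 ≤ γ := (worstFocusedRisk_mem_Icc hsys _).1.trans hγ.1
    have hsubset := broadFeasible_subset hsys he heα hα' hα'sys hγ0
    have h1 := one_mem_broadFeasible hsys hM hγ0 hγ.1
    have hl := (isCompact_feasible (broadMatrix αsys α) (focusedMatrix αsys α) γ).isLeast_sInf
      ⟨1, h1⟩
    have hl' := (isCompact_feasible (broadMatrix αsys α') (focusedMatrix αsys α') γ).isLeast_sInf
      ⟨1, hsubset h1⟩
    exact ⟨hl, hl', hl'.2 (hsubset hl.1)⟩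
  · rintro _ ⟨γ, hγ, rfl⟩
    have hpos : ∀ j, α' j ∈ Set.Ioi 0 := fun j => hsys.trans_le (hα'sys j)
    have hmono : ∀ i j, i ≤ j → worstBroadRisk αsys (α' j) ≤ worstBroadRisk αsys (α' i) :=
      fun i j hij => antitoneOn_worstBroadRisk hsys (hpos i) (hpos j) (hα'.monotone hij)
    refine ⟨(vf αsys γ α', γ), ⟨γ, ⟨?_, ?_⟩, rfl⟩, ?_, le_rfl⟩
    · refine le_trans ?_ hγ.1
      rw [lastGain, lastGain, ← heα]
      refine hmono _ _ (Fin.le_def.mpr ?_)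
      have := (e ⟨M - 1, Nat.sub_lt hM one_pos⟩).isLt
      simp only
      omega
    · refine hγ.2.trans ?_
      rw [firstGain, firstGain, ← heα]
      exact hmono _ _ (Fin.le_def.mpr (Nat.zero_le _))
    · exact (part1 γ ⟨hγ.1, hγ.2.trans (worstBroadRisk_mem_Icc hsys _).2⟩).2.2
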